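/- All Banach lattices are real and an operator is a bounded linear map. For a Banach lattice $E$, the norm dual $E'$ is a Banach lattice for the order $f\le g \iff f(x)\le g(x)$ for all $x\ge 0$. A sequence $(x_n)$ in $E$ is uaw-null if $|x_n|\wedge u\to 0$ weakly for every $u\in E^+$; it is order bounded if it lies in some order interval $[a,b]$. The solid hull of $A\subset E$ is $\mathrm{sol}(A)=\{y\in E: |y|\le |a| \text{ for some } a\in A\}$. A nonempty norm bounded set $A\subset E$ is L-weakly compact if $\|y_n\|\to 0$ for every sequence $(y_n)$ in $\mathrm{sol}(A)$ with $|y_n|\wedge|y_m|=0$ for $n\ne m$. $E$ is order continuous if $\|x_\alpha\|\to 0$ for every decreasing net $(x_\alpha)$ in $E$ with infimum $0$. Let $E$ and $F$ be Banach lattices. (a) For every operator $T:E\to F$, with adjoint $T':F'\to E'$, $T'f=f\circ T$, the following are equivalent: (1) $T[-x,x]$ is an L-weakly compact subset of $F$ for every $x\in E^+$; (2) for every norm bounded uaw-null sequence $(f_n)$ in $F'$, $|T'f_n|\to 0$ weak* in $E'$; (3) for every order bounded sequence $(x_n)$ in $E$ and every norm bounded uaw-null sequence $(f_n)$ in $F'$,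 $f_n(Tx_n)\to 0$. (b) The following are equivalent: (1) $[-x,x]$ is L-weakly compact for every $x\in E^+$; (2) for every norm bounded uaw-null sequence $(f_n)$ in $E'$, $|f_n|\to 0$ weak* in $E'$; (3) $E$ is order continuous. -/

import Mathlib

open Set Filter Topology

/-! ### The dual of a Banach lattice as a Banach lattice

The norm dual `StrongDual ℝ E` is ordered by `f ≤ g ↔ ∀ x ≥ 0, f x ≤ g x`. It is a lattice by the
Riesz-Kantorovich formula: for `x ≥ 0` the value of `f⁺ = f ⊔ 0` at `x` is
`sup {f y | 0 ≤ y ≤ x}`. -/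

set_option linter.unusedSectionVars false

namespace DualLattice

variable {E : Type*} [NormedAddCommGroup E] [NormedSpace ℝ E] [Lattice E]

/-- The function `x ↦ sup {f y | 0 ≤ y ≤ x}`, which is `f⁺` on the positive cone. -/
noncomputable def posFun (f : StrongDual ℝ E) (x : E) : ℝ := sSup (f '' Icc 0 x)

variable [IsOrderedAddMonoid E] [HasSolidNorm E]

theorem le_of_mem (f : StrongDual ℝ E) {x y : E} (hy : y ∈ Icc 0 x) : f y ≤ ‖f‖ * ‖x‖ := by
  have hx : 0 ≤ x := hy.1.trans hy.2
  have h1 : ‖y‖ ≤ ‖x‖ := by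
    apply HasSolidNorm.solid
    rw [abs_of_nonneg hy.1, abs_of_nonneg hx]
    exact hy.2
  calc f y ≤ ‖f y‖ := Real.le_norm_self _
    _ ≤ ‖f‖ * ‖y‖ := f.le_opNorm y
    _ ≤ ‖f‖ * ‖x‖ := by gcongr

theorem bddAbove (f : StrongDual ℝ E) (x : E) : BddAbove (f '' Icc 0 x) := by
  refine ⟨‖f‖ * ‖x‖, ?_⟩
  rintro _ ⟨y, hy, rfl⟩
  exact le_of_mem f hy

theorem le_posFun (f : StrongDual ℝ E) {x y : E} (hy : y ∈ Icc 0 x) : f y ≤ posFun f x :=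
  le_csSup (bddAbove f x) ⟨y, hy, rfl⟩

theorem posFun_le (f : StrongDual ℝ E) {x : E} (hx : 0 ≤ x) {c : ℝ}
    (h : ∀ y ∈ Icc 0 x, f y ≤ c) : posFun f x ≤ c := by
  apply csSup_le
  · exact ⟨f 0, 0, ⟨le_rfl, hx⟩, rfl⟩
  · rintro _ ⟨y, hy, rfl⟩
    exact h y hy

theorem posFun_nonneg (f : StrongDual ℝ E) {x : E} (hx : 0 ≤ x) : 0 ≤ posFun f x := by
  simpa using le_posFun f (x := x) (y := 0) ⟨le_rfl, hx⟩

theorem posFun_add (f : StrongDual ℝ E) {x y : E} (hx : 0 ≤ x) (hy : 0 ≤ y) :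
    posFun f (x + y) = posFun f x + posFun f y := by
  apply le_antisymm
  · refine posFun_le f (add_nonneg hx hy) fun z hz => ?_
    have h1 : f (z ⊓ x) ≤ posFun f x := le_posFun f ⟨le_inf hz.1 hx, inf_le_right⟩
    have h2 : f (z - z ⊓ x) ≤ posFun f y := by
      refine le_posFun f ⟨sub_nonneg.2 inf_le_left, ?_⟩
      rw [sub_le_comm]
      refine le_inf ((sub_le_self_iff z).2 hy) ?_
      rw [sub_le_iff_le_add]
      exact hz.2
    rw [map_sub] at h2
    linarith
  · have h1 : posFun f x ≤ posFun f (x + y) - posFun f y := by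
      refine posFun_le f hx fun z hz => ?_
      have h2 : posFun f y ≤ posFun f (x + y) - f z := by
        refine posFun_le f hy fun w hw => ?_
        have h3 : f (z + w) ≤ posFun f (x + y) :=
          le_posFun f ⟨add_nonneg hz.1 hw.1, add_le_add hz.2 hw.2⟩
        rw [map_add] at h3
        linarith
      linarith
    linarith

/-- The positive part `f⁺` as an additive map on all of `E`. -/
noncomputable def posHom (f : StrongDual ℝ E) : E →+ ℝ :=
  AddMonoidHom.mk' (fun x => posFun f x⁺ - posFun f x⁻) fun x y => by
    have e : (x + y)⁺ + (x⁻ + y⁻) = (x + y)⁻ + (x⁺ + y⁺) := by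
      have h1 := posPart_sub_negPart (x + y)
      have h2 := posPart_sub_negPart x
      have h3 := posPart_sub_negPart y
      rw [← sub_eq_zero]
      calc (x + y)⁺ + (x⁻ + y⁻) - ((x + y)⁻ + (x⁺ + y⁺))
          = ((x + y)⁺ - (x + y)⁻) - ((x⁺ - x⁻) + (y⁺ - y⁻)) := by abel
        _ = 0 := by rw [h1, h2, h3, sub_self]
    have e' := congrArg (posFun f) e
    have hp := posPart_nonneg (α := E)
    have hn := negPart_nonneg (α := E)
    rw [posFun_add f (hp _) (add_nonneg (hn _) (hn _)), posFun_add f (hn _) (hn _),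
      posFun_add f (hn _) (add_nonneg (hp _) (hp _)), posFun_add f (hp _) (hp _)] at e'
    linarith

theorem posHom_apply (f : StrongDual ℝ E) {x : E} (hx : 0 ≤ x) : posHom f x = posFun f x := by
  have h0 : posFun f (0 : E) = 0 := by simp [posFun]
  change posFun f x⁺ - posFun f x⁻ = _
  rw [posPart_of_nonneg hx, negPart_of_nonneg hx, h0, sub_zero]

theorem posHom_bound (f : StrongDual ℝ E) (x : E) : ‖posHom f x‖ ≤ ‖f‖ * ‖x‖ := by
  have h (z : E) (hz : 0 ≤ z) (hzx : |z| ≤ |x|) : posFun f z ≤ ‖f‖ * ‖x‖ :=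
    posFun_le f hz fun y hy => (le_of_mem f hy).trans
      (mul_le_mul_of_nonneg_left (HasSolidNorm.solid hzx) (norm_nonneg f))
  have h1 : posFun f x⁺ ≤ ‖f‖ * ‖x‖ := h _ (posPart_nonneg x) <| by
    rw [abs_of_nonneg (posPart_nonneg x), ← posPart_add_negPart x]
    exact le_add_of_nonneg_right (negPart_nonneg x)
  have h2 : posFun f x⁻ ≤ ‖f‖ * ‖x‖ := h _ (negPart_nonneg x) <| by
    rw [abs_of_nonneg (negPart_nonneg x), ← posPart_add_negPart x]
    exact le_add_of_nonneg_left (posPart_nonneg x)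
  have h3 := posFun_nonneg f (posPart_nonneg x)
  have h4 := posFun_nonneg f (negPart_nonneg x)
  change |posFun f x⁺ - posFun f x⁻| ≤ _
  rw [abs_le]
  constructor <;> linarith

/-- The positive part `f⁺` of a functional `f`. -/
noncomputable def pos (f : StrongDual ℝ E) : StrongDual ℝ E :=
  (posHom f).toRealLinearMap
    (AddMonoidHomClass.continuous_of_bound (posHom f) ‖f‖ (posHom_bound f))

theorem pos_apply (f : StrongDual ℝ E) {x : E} (hx : 0 ≤ x) : pos f x = posFun f x :=
  posHom_apply f hx

theorem pos_nonneg (f : StrongDual ℝ E) {x : E} (hx : 0 ≤ x) : 0 ≤ pos f x := by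
  rw [pos_apply f hx]
  exact posFun_nonneg f hx

theorem le_pos (f : StrongDual ℝ E) {x : E} (hx : 0 ≤ x) : f x ≤ pos f x := by
  rw [pos_apply f hx]
  exact le_posFun f ⟨hx, le_rfl⟩

theorem pos_le {f g : StrongDual ℝ E} (h0 : ∀ x, 0 ≤ x → 0 ≤ g x) (hf : ∀ x, 0 ≤ x → f x ≤ g x)
    {x : E} (hx : 0 ≤ x) : pos f x ≤ g x := by
  rw [pos_apply f hx]
  refine posFun_le f hx fun y hy => (hf y hy.1).trans ?_
  have h := h0 (x - y) (sub_nonneg.2 hy.2)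
  rw [map_sub] at h
  linarith

/-- The order of the dual: `f ≤ g` iff `f x ≤ g x` for all `x ≥ 0`. -/
noncomputable instance instPartialOrder : PartialOrder (StrongDual ℝ E) where
  le f g := ∀ x, 0 ≤ x → f x ≤ g x
  le_refl _ _ _ := le_rfl
  le_trans _ _ _ h1 h2 x hx := (h1 x hx).trans (h2 x hx)
  le_antisymm f g h1 h2 := by
    ext x
    have hp := le_antisymm (h1 _ (posPart_nonneg x)) (h2 _ (posPart_nonneg x))
    have hn := le_antisymm (h1 _ (negPart_nonneg x)) (h2 _ (negPart_nonneg x))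
    rw [← posPart_sub_negPart x, map_sub, map_sub, hp, hn]

/-- The lattice operations of the dual. -/
noncomputable instance instLattice : Lattice (StrongDual ℝ E) where
  sup f g := g + pos (f - g)
  inf f g := f - pos (f - g)
  le_sup_left f g x hx := by
    have h := le_pos (f - g) hx
    simp only [sub_apply, add_apply] at h ⊢
    linarith
  le_sup_right f g x hx := by
    have h := pos_nonneg (f - g) hx
    simp only [add_apply]
    linarith
  sup_le f g k hf hg x hx := by
    have h := pos_le (f := f - g) (g := k - g)
      (fun y hy => by simpa using hg y hy) (fun y hy => by simpa using hf y hy) hx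
    simp only [sub_apply, add_apply] at h ⊢
    linarith
  inf_le_left f g x hx := by
    have h := pos_nonneg (f - g) hx
    simp only [sub_apply]
    linarith
  inf_le_right f g x hx := by
    have h := le_pos (f - g) hx
    simp only [sub_apply] at h ⊢
    linarith
  le_inf k f g hf hg x hx := by
    have h := pos_le (f := f - g) (g := f - k)
      (fun y hy => by simpa using hf y hy)
      (fun y hy => by simpa using sub_le_sub_left (hg y hy) (f y)) hx
    simp only [sub_apply] at h ⊢
    linarith

theorem le_def {f g : StrongDual ℝ E} : f ≤ g ↔ ∀ x, 0 ≤ x → f x ≤ g x := Iff.rfl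

instance instIsOrderedAddMonoid : IsOrderedAddMonoid (StrongDual ℝ E) where
  add_le_add_left f g h k x hx := by
    simpa using h x hx

instance instIsOrderedModule : IsOrderedModule ℝ (StrongDual ℝ E) where
  smul_le_smul_of_nonneg_left c hc f g h x hx := by
    simpa using mul_le_mul_of_nonneg_left (h x hx) hc
  smul_le_smul_of_nonneg_right f hf a b hab x hx := by
    simpa using mul_le_mul_of_nonneg_right hab (by simpa using hf x hx)

theorem apply_le_abs_apply (f : StrongDual ℝ E) (x : E) : |f x| ≤ |f| |x| := by
  have hp := posPart_nonneg x
  have hn := negPart_nonneg x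
  have h1 := le_abs_self f _ hp
  have h2 := le_abs_self f _ hn
  have h3 := neg_le_abs f _ hp
  have h4 := neg_le_abs f _ hn
  have e : f x = f x⁺ - f x⁻ := by rw [← map_sub, posPart_sub_negPart]
  rw [← posPart_add_negPart x, map_add, e, abs_le]
  simp only [neg_apply] at h3 h4
  constructor <;> linarith

theorem abs_apply_le (f : StrongDual ℝ E) {x : E} (hx : 0 ≤ x) : |f| x ≤ ‖f‖ * ‖x‖ := by
  have e : |f| = -f + pos (f - -f) := rfl
  rw [e, add_apply, pos_apply _ hx, neg_apply]
  have h : posFun (f - -f) x ≤ ‖f‖ * ‖x‖ + f x := by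
    refine posFun_le _ hx fun y hy => ?_
    have h1 : ‖y + y - x‖ ≤ ‖x‖ := by
      apply HasSolidNorm.solid
      rw [abs_of_nonneg hx, abs_le']
      constructor
      · rw [sub_le_iff_le_add]
        exact add_le_add hy.2 hy.2
      · rw [neg_sub]
        exact sub_le_self _ (add_nonneg hy.1 hy.1)
    have h2 := (Real.le_norm_self _).trans ((f.le_opNorm (y + y - x)).trans
      (mul_le_mul_of_nonneg_left h1 (norm_nonneg f)))
    simp only [map_sub, map_add, sub_apply, neg_apply]
      at h2 ⊢
    linarith
  linarith

/-- The operator norm of the dual is a lattice norm. -/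
instance instHasSolidNorm : HasSolidNorm (StrongDual ℝ E) where
  solid f g h := by
    refine f.opNorm_le_bound (norm_nonneg g) fun x => ?_
    calc ‖f x‖ ≤ |f| |x| := apply_le_abs_apply f x
      _ ≤ |g| |x| := h _ (abs_nonneg x)
      _ ≤ ‖g‖ * ‖|x|‖ := abs_apply_le g (abs_nonneg x)
      _ = ‖g‖ * ‖x‖ := by rw [norm_abs_eq_norm]

end DualLattice

/-! ### Notions for Banach lattices -/

/-- Unbounded absolutely weak convergence of `x` to `a` along `l`: for every `u ≥ 0`,
`|x i - a| ⊓ u` converges to `0` in the weak topology. -/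
def UawTendsto {E : Type*} [NormedAddCommGroup E] [NormedSpace ℝ E] [Lattice E]
    {ι : Type*} (x : ι → E) (l : Filter ι) (a : E) : Prop :=
  ∀ u : E, 0 ≤ u → Tendsto (fun i => toWeakSpace ℝ E (|x i - a| ⊓ u)) l (𝓝 0)

/-- `f` is a norm bounded uaw-null sequence. -/
def IsBoundedUawNull {E : Type*} [NormedAddCommGroup E] [NormedSpace ℝ E] [Lattice E]
    (f : ℕ → E) : Prop :=
  Bornology.IsBounded (range f) ∧ UawTendsto f atTop 0

/-- A set is L-weakly compact if it is nonempty and norm bounded, and every disjoint sequence in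
its solid hull converges to `0` in norm. -/
def IsLWeaklyCompact {E : Type*} [NormedAddCommGroup E] [Lattice E] (A : Set E) : Prop :=
  A.Nonempty ∧ Bornology.IsBounded A ∧
    ∀ x : ℕ → E, (∀ n, x n ∈ LatticeOrderedAddCommGroup.solidClosure A) →
      (∀ m n, m ≠ n → |x m| ⊓ |x n| = 0) → Tendsto (fun n => ‖x n‖) atTop (𝓝 0)

/-- A sequence is order bounded if it lies in an order interval. -/
def IsOrderBoundedSeq {E : Type*} [Preorder E] (x : ℕ → E) : Prop :=
  ∃ a b : E, ∀ n, x n ∈ Icc a b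

/-- The norm is order continuous: every net decreasing to `0` converges to `0` in norm. -/
def IsOrderContinuousLattice.{u} (E : Type u) [NormedAddCommGroup E] [Lattice E] : Prop :=
  ∀ (ι : Type u) [Preorder ι] [IsDirectedOrder ι] [Nonempty ι] (x : ι → E),
    Antitone x → IsGLB (range x) 0 → Tendsto (fun i => ‖x i‖) atTop (𝓝 0)

/-! Disjointness links the two sides of the theorem: L-weak compactness tests disjoint sequences in
`F`, and norm bounded disjoint sequences in the dual are uaw-null.

(1) ⇒ (2) in (a). By the Riesz-Kantorovich formula `|T'f| x` is the supremum of `f (T y)` over `y ∈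
[-x, x]`, so it suffices that `|f n| |a| → 0` uniformly for `a` in an L-weakly compact set. Up to a
small norm error such a set lies below one finite sum `u` of positive elements of its solid hull
(`exists_mem_closure_norm_posPart_lt`), which leaves `|f n| p → 0` for each summand `p`. Disjoint
sequences in `[0, p]` are norm null, so monotone sequences there are Cauchy
(`DisjointNull.not_forall_le_norm_sub`). Testing uaw-nullity on evaluation at `p` gives `(|f n| ⊓ g)
p → 0` for each fixed `g ≥ 0`, and a gliding hump argument then yields `|f n| p → 0`
(`DisjointNull.tendsto_apply`).

(2) ⇒ (3) is domination by `|T'f n|` at a bound of the `|x n|`. For (3) ⇒ (1), a disjoint sequence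
`y n` with `|y n| ≤ |T (z n)|` is normed by bounded disjoint functionals on the `T (z n)`, built
from components in the bands generated by the `|y n|` (`exists_disjoint_norming`).

In (b), (1) ⇔ (2) is (a) for the identity. Order continuity follows from (1) because decreasing nets
are Cauchy; conversely it makes the increasing, order bounded partial sums of a disjoint sequence
approach their upper bounds in norm. -/

namespace BanachLattice

/-! ### Disjointness in lattice-ordered groups and vector lattices -/

section LatticeGroup

variable {E : Type*} [AddCommGroup E] [Lattice E] [IsOrderedAddMonoid E]

theorem inf_add_le_of_nonneg {a b c : E} (ha : 0 ≤ a) (hb : 0 ≤ b) (hc : 0 ≤ c) :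
    (a + b) ⊓ c ≤ a ⊓ c + b ⊓ c := by
  rw [add_inf, inf_add, inf_add]
  refine le_inf (le_inf inf_le_left ?_) (le_inf ?_ ?_)
  · exact inf_le_right.trans (le_add_of_nonneg_right hb)
  · exact inf_le_right.trans (le_add_of_nonneg_left ha)
  · exact inf_le_right.trans (le_add_of_nonneg_left hc)

theorem add_le_of_inf_eq_zero {a b x : E} (h : a ⊓ b = 0) (ha : a ≤ x) (hb : b ≤ x) :
    a + b ≤ x := by
  rw [← inf_add_sup a b, h, zero_add]
  exact sup_le ha hb

theorem inf_eq_zero_of_le {a b a' b' : E} (h : a ⊓ b = 0) (ha' : 0 ≤ a') (hb' : 0 ≤ b')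
    (ha : a' ≤ a) (hb : b' ≤ b) : a' ⊓ b' = 0 :=
  le_antisymm (h ▸ inf_le_inf ha hb) (le_inf ha' hb')

theorem sum_inf_eq_zero {v : ℕ → E} (hv : ∀ n, 0 ≤ v n) {c : E} (hc : 0 ≤ c) (n : ℕ)
    (h : ∀ i < n, v i ⊓ c = 0) : (∑ i ∈ Finset.range n, v i) ⊓ c = 0 := by
  induction n with
  | zero => simpa using hc
  | succ n ih =>
    rw [Finset.sum_range_succ]
    refine le_antisymm ?_ (le_inf (add_nonneg (Finset.sum_nonneg fun i _ => hv i) (hv n)) hc)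
    refine (inf_add_le_of_nonneg (Finset.sum_nonneg fun i _ => hv i) (hv n) hc).trans ?_
    rw [ih fun i hi => h i (hi.trans n.lt_succ_self), h n n.lt_succ_self, add_zero]

theorem sum_le_of_disjoint {v : ℕ → E} (hv : ∀ n, 0 ≤ v n)
    (hd : ∀ m n, m ≠ n → v m ⊓ v n = 0) {x : E} (hx : ∀ n, v n ≤ x) (n : ℕ) :
    ∑ i ∈ Finset.range n, v i ≤ x := by
  induction n with
  | zero => simpa using (hv 0).trans (hx 0)
  | succ n ih =>
    rw [Finset.sum_range_succ]
    exact add_le_of_inf_eq_zero (sum_inf_eq_zero hv (hv n) n fun i hi => hd i n hi.ne) ih (hx n)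

theorem disjoint_of_lt {v : ℕ → E} (h : ∀ i k, i < k → v i ⊓ v k = 0) (m n : ℕ) (hmn : m ≠ n) :
    v m ⊓ v n = 0 := by
  rcases hmn.lt_or_gt with h1 | h1
  · exact h m n h1
  · rw [inf_comm]
    exact h n m h1

theorem abs_le_of_mem_Icc {x y : E} (h : y ∈ Icc (-x) x) : |y| ≤ x :=
  abs_le'.2 ⟨h.2, neg_le.1 h.1⟩

theorem posPart_sub_le {a b : E} (ha : 0 ≤ a) (hb : 0 ≤ b) : (a - b)⁺ ≤ a :=
  sup_le ((sub_le_self_iff a).2 hb) ha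

variable [Module ℝ E] [IsOrderedModule ℝ E]

theorem smul_inf_of_pos {c : ℝ} (hc : 0 < c) (a b : E) : c • (a ⊓ b) = c • a ⊓ c • b :=
  (OrderIso.smulRight (β := E) hc).map_inf a b

theorem smul_posPart_of_pos {c : ℝ} (hc : 0 < c) (a : E) : c • a⁺ = (c • a)⁺ := by
  refine ((OrderIso.smulRight (β := E) hc).map_sup a 0).trans ?_
  change c • a ⊔ c • (0 : E) = (c • a) ⊔ 0
  rw [smul_zero]

theorem inf_smul_eq_zero {a b : E} (ha : 0 ≤ a) (hb : 0 ≤ b) (h : a ⊓ b = 0) {c : ℝ}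
    (hc : 0 ≤ c) : a ⊓ c • b = 0 := by
  have hM : 0 < max 1 c := lt_of_lt_of_le one_pos (le_max_left _ _)
  have h' : (max 1 c • a) ⊓ (max 1 c • b) = 0 := by
    rw [← smul_inf_of_pos hM, h, smul_zero]
  refine inf_eq_zero_of_le h' ha (smul_nonneg hc hb) ?_ ?_
  · simpa using smul_le_smul_of_nonneg_right (le_max_left 1 c) ha
  · exact smul_le_smul_of_nonneg_right (le_max_right 1 c) hb

/-- Source of disjointness in both later constructions: `(b - t⁻¹ • a)⁺` is a multiple of `(a - t •
b)⁻`, hence disjoint from `(a - t • b)⁺`, and `s ≥ t⁻¹` only shrinks it. -/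
theorem posPart_sub_smul_inf_eq_zero {a b : E} (ha : 0 ≤ a) {t s : ℝ} (ht : 0 < t)
    (hts : 1 ≤ t * s) : (a - t • b)⁺ ⊓ (b - s • a)⁺ = 0 := by
  have h1 : (a - t • b)⁺ ⊓ t⁻¹ • (a - t • b)⁻ = 0 :=
    inf_smul_eq_zero (posPart_nonneg _) (negPart_nonneg _) (posPart_inf_negPart_eq_zero _)
      (inv_nonneg.2 ht.le)
  refine inf_eq_zero_of_le h1 (posPart_nonneg _) (posPart_nonneg _) le_rfl ?_
  have h2 : t⁻¹ • (a - t • b)⁻ = (b - t⁻¹ • a)⁺ := by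
    rw [← posPart_neg, smul_posPart_of_pos (inv_pos.2 ht), neg_sub, smul_sub, smul_smul,
      inv_mul_cancel₀ ht.ne', one_smul]
  rw [h2]
  refine posPart_mono (sub_le_sub_left (smul_le_smul_of_nonneg_right ?_ ha) _)
  rw [inv_le_iff_one_le_mul₀' ht]
  exact hts

end LatticeGroup

/-! ### Riesz-Kantorovich formulas and positive functionals -/

section Dual

variable {E : Type*} [NormedAddCommGroup E] [NormedSpace ℝ E]
  [Lattice E] [IsOrderedAddMonoid E] [HasSolidNorm E]

theorem norm_le_of_nonneg_of_le {a b : E} (ha : 0 ≤ a) (h : a ≤ b) : ‖a‖ ≤ ‖b‖ :=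
  HasSolidNorm.solid (abs_le_abs_of_nonneg ha h)

theorem apply_mono {f : StrongDual ℝ E} (hf : 0 ≤ f) {x y : E} (h : x ≤ y) : f x ≤ f y := by
  have := hf (y - x) (sub_nonneg.2 h)
  simpa using this

theorem apply_nonneg {f : StrongDual ℝ E} (hf : 0 ≤ f) {x : E} (h : 0 ≤ x) : 0 ≤ f x := by
  simpa using hf x h

/-- Since `|f| = -f + (2f)⁺`, the map `y ↦ 2y - x` from `[0, x]` to `[-x, x]` turns the formula for
the positive part into one for the modulus. -/
theorem abs_apply_le_of_forall {f : StrongDual ℝ E} {x : E} (hx : 0 ≤ x) {c : ℝ}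
    (h : ∀ y ∈ Icc (-x) x, f y ≤ c) : |f| x ≤ c := by
  have e : |f| = -f + DualLattice.pos (f - -f) := rfl
  rw [e, add_apply, DualLattice.pos_apply _ hx, neg_apply]
  have : DualLattice.posFun (f - -f) x ≤ c + f x := by
    refine DualLattice.posFun_le _ hx fun y hy => ?_
    have h1 := h (y + y - x) ⟨?_, ?_⟩
    · simp only [map_sub, map_add, sub_apply, neg_apply] at h1 ⊢
      linarith
    · simpa [sub_eq_add_neg] using add_nonneg hy.1 hy.1
    · rw [sub_le_iff_le_add]
      exact add_le_add hy.2 hy.2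
  linarith

theorem inf_apply_le (f g : StrongDual ℝ E) {x z : E} (hz : 0 ≤ z) (hzx : z ≤ x) :
    (f ⊓ g) x ≤ f z + g (x - z) := by
  have h1 : (f ⊓ g) z ≤ f z := (inf_le_left : f ⊓ g ≤ f) z hz
  have h2 : (f ⊓ g) (x - z) ≤ g (x - z) := (inf_le_right : f ⊓ g ≤ g) _ (sub_nonneg.2 hzx)
  have h3 : (f ⊓ g) x = (f ⊓ g) z + (f ⊓ g) (x - z) := by rw [← map_add]; simp
  linarith

theorem exists_add_lt_of_inf_apply_lt {f g : StrongDual ℝ E} {x : E} (hx : 0 ≤ x) {c : ℝ}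
    (h : (f ⊓ g) x < c) : ∃ z ∈ Icc 0 x, f (x - z) + g z < c := by
  by_contra! H
  have e : f ⊓ g = f - DualLattice.pos (f - g) := rfl
  rw [e, sub_apply, DualLattice.pos_apply _ hx] at h
  have : DualLattice.posFun (f - g) x ≤ f x - c := by
    refine DualLattice.posFun_le _ hx fun y hy => ?_
    have := H y hy
    simp only [map_sub, sub_apply] at this ⊢
    linarith
  linarith

theorem exists_nonneg_norming {x : E} (hx : 0 ≤ x) :
    ∃ f : StrongDual ℝ E, 0 ≤ f ∧ ‖f‖ ≤ 1 ∧ f x = ‖x‖ := by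
  obtain ⟨g, hg, hgx⟩ := exists_dual_vector'' ℝ x
  refine ⟨|g|, abs_nonneg g, by rwa [norm_abs_eq_norm], le_antisymm ?_ ?_⟩
  · refine (DualLattice.abs_apply_le g hx).trans ?_
    nlinarith [norm_nonneg x]
  · have := le_abs_self g x hx
    simpa [hgx] using this

/-- A norm-bounded nonnegative function that is additive on the positive cone is the restriction
of a functional. -/
theorem exists_functional_of_additive {p : E → ℝ} {C : ℝ} (h0 : ∀ x, 0 ≤ x → 0 ≤ p x)
    (hadd : ∀ x y, 0 ≤ x → 0 ≤ y → p (x + y) = p x + p y)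
    (hC : ∀ x, 0 ≤ x → p x ≤ C * ‖x‖) :
    ∃ f : StrongDual ℝ E, ∀ x, 0 ≤ x → f x = p x := by
  have hp := posPart_nonneg (α := E)
  have hn := negPart_nonneg (α := E)
  let q : E →+ ℝ := AddMonoidHom.mk' (fun x => p x⁺ - p x⁻) fun x y => by
    have e : (x + y)⁺ + (x⁻ + y⁻) = (x + y)⁻ + (x⁺ + y⁺) := by
      have h1 := posPart_sub_negPart (x + y)
      have h2 := posPart_sub_negPart x
      have h3 := posPart_sub_negPart y
      rw [← sub_eq_zero]
      calc (x + y)⁺ + (x⁻ + y⁻) - ((x + y)⁻ + (x⁺ + y⁺))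
          = ((x + y)⁺ - (x + y)⁻) - ((x⁺ - x⁻) + (y⁺ - y⁻)) := by abel
        _ = 0 := by rw [h1, h2, h3, sub_self]
    have e' := congrArg p e
    rw [hadd _ _ (hp _) (add_nonneg (hn _) (hn _)), hadd _ _ (hn _) (hn _),
      hadd _ _ (hn _) (add_nonneg (hp _) (hp _)), hadd _ _ (hp _) (hp _)] at e'
    linarith
  have hq : ∀ x, ‖q x‖ ≤ |C| * ‖x‖ := fun x => by
    have hz (z : E) (hz : 0 ≤ z) (hzx : z ≤ |x|) : p z ≤ |C| * ‖x‖ := by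
      refine (hC z hz).trans ?_
      rw [← norm_abs_eq_norm x]
      exact mul_le_mul (le_abs_self C) (norm_le_of_nonneg_of_le hz hzx) (norm_nonneg _)
        (abs_nonneg _)
    have h1 := hz _ (hp x) (by
      rw [← posPart_add_negPart x]; exact le_add_of_nonneg_right (hn x))
    have h2 := hz _ (hn x) (by
      rw [← posPart_add_negPart x]; exact le_add_of_nonneg_left (hp x))
    have h3 := h0 _ (hp x)
    have h4 := h0 _ (hn x)
    change |p x⁺ - p x⁻| ≤ _
    rw [abs_le]
    constructor <;> linarith
  refine ⟨q.toRealLinearMap (AddMonoidHomClass.continuous_of_bound q |C| hq), fun x hx => ?_⟩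
  have hp0 : p 0 = 0 := by simpa using hadd 0 0 le_rfl le_rfl
  change p x⁺ - p x⁻ = p x
  rw [posPart_of_nonneg hx, negPart_of_nonneg hx, hp0, sub_zero]

end Dual

/-! ### Order intervals whose disjoint sequences are norm null -/

section OrderInterval

variable {E : Type*} [NormedAddCommGroup E] [NormedSpace ℝ E]
  [Lattice E] [IsOrderedAddMonoid E] [IsOrderedModule ℝ E] [HasSolidNorm E]

/-- Every disjoint sequence in the order interval `[0, a]` is norm null. -/
def DisjointNull {E : Type*} [NormedAddCommGroup E] [Lattice E] (a : E) : Prop :=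
  ∀ v : ℕ → E, (∀ n, v n ∈ Icc 0 a) → (∀ m n, m ≠ n → v m ⊓ v n = 0) →
    Tendsto (fun n => ‖v n‖) atTop (𝓝 0)

theorem apply_le_norm_of_mem_Icc {f : StrongDual ℝ E} (hf : ‖f‖ ≤ 1) {a x : E}
    (hx : x ∈ Icc 0 a) : f x ≤ ‖a‖ :=
  (DualLattice.le_of_mem f hx).trans (by nlinarith [norm_nonneg a])

/-- Otherwise increments of size `η` add up: for each `N` some `x m` has `f n (x m) ≥ N * η` for all
large `n`, against the bound `‖a‖`. -/
theorem exists_frequently_apply_sub_lt {a : E} {x : ℕ → E}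
    (hxa : ∀ n, x n ∈ Icc 0 a) {f : ℕ → StrongDual ℝ E} (hf0 : ∀ n, 0 ≤ f n)
    (hf1 : ∀ n, ‖f n‖ ≤ 1) {η : ℝ} (hη : 0 < η) :
    ∃ m₀, ∀ m, m₀ ≤ m → ∃ᶠ n in atTop, f n (x m - x m₀) < η := by
  by_contra! H
  have key : ∀ N : ℕ, ∃ m, ∀ᶠ n in atTop, N * η ≤ f n (x m) := by
    intro N
    induction N with
    | zero => exact ⟨0, Eventually.of_forall fun n => by simpa using apply_nonneg (hf0 n) (hxa 0).1⟩
    | succ N ih =>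
      obtain ⟨m, hm⟩ := ih
      obtain ⟨m', -, hm'⟩ := H m
      refine ⟨m', ?_⟩
      filter_upwards [hm, hm'] with n h1 h2
      rw [map_sub] at h2
      push_cast
      linarith
  obtain ⟨N, hN⟩ := exists_nat_gt (‖a‖ / η)
  obtain ⟨m, hm⟩ := key N
  obtain ⟨n, hn⟩ := hm.exists
  rw [div_lt_iff₀ hη] at hN
  linarith [apply_le_norm_of_mem_Icc (hf1 n) (hxa m)]

/-- Large increments, thinned out and trimmed, become a disjoint sequence in `[0, a]` of norm at
least `ε / 2`. -/
theorem DisjointNull.not_forall_le_norm_sub {a : E} (hnull : DisjointNull a) {x : ℕ → E}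
    (hx : Monotone x) (hxa : ∀ n, x n ∈ Icc 0 a) {ε : ℝ} (hε : 0 < ε) :
    ¬ ∀ n, ε ≤ ‖x (n + 1) - x n‖ := by
  intro hgap
  have ha : 0 ≤ a := (hxa 0).1.trans (hxa 0).2
  have hy0 : ∀ n, 0 ≤ x (n + 1) - x n := fun n => sub_nonneg.2 (hx n.le_succ)
  have hya : ∀ n, x (n + 1) - x n ≤ a := fun n =>
    (sub_le_self _ (hxa n).1).trans (hxa _).2
  choose f hf0 hf1 hfy using fun n => exists_nonneg_norming (hy0 n)
  obtain ⟨K, hK0, hK⟩ : ∃ K : ℝ, 0 < K ∧ K⁻¹ * ‖a‖ ≤ ε / 4 := by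
    refine ⟨(‖a‖ + 1) * (4 / ε), by positivity, ?_⟩
    rw [inv_mul_le_iff₀ (by positivity)]
    have : (‖a‖ + 1) * (4 / ε) * (ε / 4) = ‖a‖ + 1 := by field_simp
    linarith
  have hη : 0 < K⁻¹ * (ε / 4) := by positivity
  obtain ⟨m₀, hm₀⟩ := exists_frequently_apply_sub_lt hxa hf0 hf1 hη
  have hstep : ∀ k, m₀ ≤ k → ∃ n, k < n ∧ f n (x (k + 1) - x m₀) < K⁻¹ * (ε / 4) := fun k hk =>
    let ⟨n, hn, h⟩ := ((hm₀ (k + 1) (by omega)).and_eventually (eventually_gt_atTop k)).exists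
    ⟨n, h, hn⟩
  choose! φ hφ1 hφ2 using hstep
  let ν : ℕ → ℕ := fun k => φ^[k] m₀
  have hν : ∀ k, ν (k + 1) = φ (ν k) := fun k => Function.iterate_succ_apply' φ k m₀
  have hνm : ∀ k, m₀ ≤ ν k := by
    intro k
    induction k with
    | zero => exact le_rfl
    | succ k ih => rw [hν]; exact ih.trans (hφ1 _ ih).le
  have hνs : StrictMono ν := strictMono_nat_of_lt_succ fun k => by
    rw [hν]; exact hφ1 _ (hνm k)
  let y : ℕ → E := fun k => x (ν (k + 1) + 1) - x (ν (k + 1))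
  -- `s k` dominates every earlier increment `y i`, `i < k`, yet the functional norming `y k` is
  -- below `ε / (4K)` on it.
  let s : ℕ → E := fun k => x (ν k + 1) - x m₀
  have hs0 : ∀ k, 0 ≤ s k := fun k => sub_nonneg.2 (hx ((hνm k).trans (Nat.le_succ _)))
  -- Subtracting `K • s k` separates `y k` from earlier increments, and `K⁻¹ • a` from later ones.
  -- Each costs at most `ε / 4` under the norming functional.
  let v : ℕ → E := fun k => (y k - K • s k - K⁻¹ • a)⁺
  have hsK : ∀ k, 0 ≤ K • s k := fun k => smul_nonneg hK0.le (hs0 k)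
  have haK : 0 ≤ K⁻¹ • a := smul_nonneg (inv_pos.2 hK0).le ha
  have hva : ∀ k, v k ∈ Icc 0 a := fun k => by
    refine ⟨posPart_nonneg _, ?_⟩
    have : v k = (y k - (K • s k + K⁻¹ • a))⁺ := by rw [← sub_sub]
    rw [this]
    exact (posPart_sub_le (hy0 _) (add_nonneg (hsK k) haK)).trans (hya _)
  have hdisj : ∀ i k, i < k → v i ⊓ v k = 0 := by
    intro i k hik
    have hK1 : 1 ≤ K⁻¹ * K := by rw [inv_mul_cancel₀ hK0.ne']
    refine inf_eq_zero_of_le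
      (posPart_sub_smul_inf_eq_zero (a := y i) (b := y k) (hy0 _) (inv_pos.2 hK0) hK1)
      (posPart_nonneg _) (posPart_nonneg _) (posPart_mono ?_) (posPart_mono ?_)
    · refine (sub_le_sub_right (sub_le_self _ (hsK i)) _).trans (sub_le_sub_left ?_ _)
      exact smul_le_smul_of_nonneg_left (hya _) (inv_pos.2 hK0).le
    · refine (sub_le_self _ haK).trans (sub_le_sub_left ?_ _)
      refine smul_le_smul_of_nonneg_left ?_ hK0.le
      exact sub_le_sub (hx (Nat.succ_le_succ (hνs.monotone hik))) (hx (hνm _))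
  have hlow : ∀ k, ε / 2 ≤ ‖v k‖ := by
    intro k
    have h1 : f (ν (k + 1)) (y k - K • s k - K⁻¹ • a) ≤ f (ν (k + 1)) (v k) :=
      apply_mono (hf0 _) (le_posPart _)
    have h2 : f (ν (k + 1)) (v k) ≤ ‖v k‖ :=
      apply_le_norm_of_mem_Icc (hf1 _) ⟨(hva k).1, le_rfl⟩
    have h3 : f (ν (k + 1)) (s k) < K⁻¹ * (ε / 4) := by
      rw [hν]; exact hφ2 _ (hνm k)
    have h4 : f (ν (k + 1)) a ≤ ‖a‖ := apply_le_norm_of_mem_Icc (hf1 _) ⟨ha, le_rfl⟩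
    have h5 : f (ν (k + 1)) (y k) = ‖y k‖ := hfy _
    have h6 : ε ≤ ‖y k‖ := hgap _
    have h7 : K * f (ν (k + 1)) (s k) ≤ ε / 4 := by
      rw [← le_inv_mul_iff₀ hK0]; exact h3.le
    have h8 : K⁻¹ * f (ν (k + 1)) a ≤ ε / 4 :=
      (mul_le_mul_of_nonneg_left h4 (inv_pos.2 hK0).le).trans hK
    simp only [map_sub, map_smul, smul_eq_mul] at h1
    linarith
  have hlim := hnull v hva (disjoint_of_lt hdisj)
  have := ge_of_tendsto' hlim hlow
  linarith

/-- A failure can be iterated to a sequence along the net; its complements in `a` increase with gaps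
at least `ε`. -/
theorem DisjointNull.exists_norm_sub_lt {a : E} (hnull : DisjointNull a) {ι : Type*} [Preorder ι]
    [Nonempty ι] {x : ι → E} (hx : Antitone x) (hxa : ∀ i, x i ∈ Icc 0 a) {ε : ℝ} (hε : 0 < ε) :
    ∃ i, ∀ j, i ≤ j → ‖x i - x j‖ < ε := by
  by_contra! H
  choose φ hφ1 hφ2 using H
  obtain ⟨i₀⟩ := ‹Nonempty ι›
  let ν : ℕ → ι := fun k => φ^[k] i₀
  have hν : ∀ k, ν (k + 1) = φ (ν k) := fun k => Function.iterate_succ_apply' φ k i₀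
  have hmono : Monotone ν := monotone_nat_of_le_succ fun k => by rw [hν]; exact hφ1 _
  refine hnull.not_forall_le_norm_sub (x := fun k => a - x (ν k))
    (fun m n h => sub_le_sub_left (hx (hmono h)) _)
    (fun n => ⟨sub_nonneg.2 (hxa _).2, sub_le_self _ (hxa _).1⟩) hε fun n => ?_
  rw [sub_sub_sub_cancel_left, hν]
  exact hφ2 _

theorem DisjointNull.cauchy {a : E} (hnull : DisjointNull a) {ι : Type*} [Preorder ι]
    [IsDirectedOrder ι] [Nonempty ι] {x : ι → E} (hx : Antitone x) (hxa : ∀ i, x i ∈ Icc 0 a) :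
    Cauchy (map x atTop) := by
  rw [Metric.cauchy_iff]
  refine ⟨inferInstance, fun ε hε => ?_⟩
  obtain ⟨i, hi⟩ := hnull.exists_norm_sub_lt hx hxa (half_pos hε)
  refine ⟨x '' Ici i, image_mem_map (mem_atTop i), ?_⟩
  rintro _ ⟨j, hj, rfl⟩ _ ⟨k, hk, rfl⟩
  have h1 := hi j hj
  have h2 := hi k hk
  rw [← dist_eq_norm] at h1 h2
  have := dist_triangle_left (x j) (x k) (x i)
  linarith

theorem DisjointNull.exists_tendsto_partialSups [CompleteSpace E] {a : E}
    (hnull : DisjointNull a) {z : ℕ → E} (hz : ∀ n, z n ∈ Icc 0 a) :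
    ∃ w, Tendsto (fun n => partialSups z n) atTop (𝓝 w) := by
  have hc := hnull.cauchy (x := fun n => a - partialSups z n)
    (fun m n h => sub_le_sub_left ((partialSups z).monotone h) _)
    (fun n => ⟨sub_nonneg.2 (partialSups_le z n a fun j _ => (hz j).2),
      sub_le_self _ ((hz 0).1.trans (le_partialSups_of_le z n.zero_le))⟩)
  obtain ⟨w, hw⟩ := CompleteSpace.complete hc
  refine ⟨a - w, ?_⟩
  have hw' : Tendsto (fun n => a - partialSups z n) atTop (𝓝 w) := hw
  simpa using hw'.const_sub a

/-- If disjoint sequences in `[0, a]` are norm null, a bounded sequence of positive functionals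
whose infima with each fixed functional vanish at `a` in the limit vanishes at `a`. -/
theorem DisjointNull.tendsto_apply [CompleteSpace E] {a : E} (ha : 0 ≤ a)
    (hnull : DisjointNull a) {f : ℕ → StrongDual ℝ E} (hf0 : ∀ n, 0 ≤ f n) {C : ℝ}
    (hfC : ∀ n, ‖f n‖ ≤ C)
    (hf : ∀ g : StrongDual ℝ E, 0 ≤ g → Tendsto (fun n => (f n ⊓ g) a) atTop (𝓝 0)) :
    Tendsto (fun n => f n a) atTop (𝓝 0) := by
  rw [Metric.tendsto_atTop]
  by_contra! H
  obtain ⟨ε, hε, H⟩ := H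
  have hstep : ∀ g : {g : StrongDual ℝ E // 0 ≤ g}, ∃ n, ∃ z ∈ Icc 0 a,
      ε ≤ f n a ∧ f n (a - z) + g.1 z < ε / 4 := by
    rintro ⟨g, hg⟩
    obtain ⟨N, hN⟩ := eventually_atTop.1 ((hf g hg).eventually_lt_const (show 0 < ε / 4 by linarith))
    obtain ⟨n, hn, hfn⟩ := H N
    obtain ⟨z, hz, hzlt⟩ := exists_add_lt_of_inf_apply_lt ha (hN n hn)
    refine ⟨n, z, hz, ?_, hzlt⟩
    rwa [Real.dist_0_eq_abs, abs_of_nonneg (apply_nonneg (hf0 n) ha)] at hfn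
  choose n z hz hfa hfz using hstep
  -- Each `G k` dominates growing multiples of the earlier `h i`, and `h k ⊓ G k` is small at `a`.
  -- So `ζ k` carries most of `h k a`, while the earlier `h i` are geometrically small on it.
  let G : ℕ → {g : StrongDual ℝ E // 0 ≤ g} := fun k => Nat.rec ⟨0, le_rfl⟩
    (fun _ g => ⟨2 • (g.1 + f (n g)), nsmul_nonneg (add_nonneg g.2 (hf0 _)) 2⟩) k
  have hG : ∀ k, (G (k + 1)).1 = 2 • ((G k).1 + f (n (G k))) := fun k => rfl
  let h : ℕ → StrongDual ℝ E := fun k => f (n (G k))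
  let ζ : ℕ → E := fun k => z (G k)
  have hζ : ∀ k, ζ k ∈ Icc 0 a := fun k => hz _
  have hGh : ∀ i j x, 0 ≤ x → (2 : ℝ) ^ (j + 1) * h i x ≤ (G (i + 1 + j)).1 x := by
    intro i j x hx
    induction j with
    | zero =>
      have := apply_nonneg (G i).2 hx
      rw [add_zero, hG]
      simp only [smul_apply, add_apply, nsmul_eq_mul, h]
      push_cast
      linarith
    | succ j ih =>
      have := apply_nonneg (hf0 (n (G (i + 1 + j)))) hx
      rw [← add_assoc, hG, pow_succ]
      simp only [smul_apply, add_apply, nsmul_eq_mul]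
      push_cast
      linarith
  have hsmall : ∀ i j, h i (ζ (i + 1 + j)) ≤ ε / 8 * (1 / 2) ^ j := by
    intro i j
    have h1 := hGh i j _ (hζ (i + 1 + j)).1
    have h2 := hfz (G (i + 1 + j))
    have h3 : 0 ≤ f (n (G (i + 1 + j))) (a - z (G (i + 1 + j))) :=
      apply_nonneg (hf0 _) (sub_nonneg.2 (hz _).2)
    have h4 : (2 : ℝ) ^ (j + 1) * h i (ζ (i + 1 + j)) ≤ ε / 4 := by
      change _ ≤ (G (i + 1 + j)).1 (z (G (i + 1 + j))) at h1
      linarith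
    rw [← le_div_iff₀' (by positivity)] at h4
    refine h4.trans_eq ?_
    rw [one_div, inv_pow, pow_succ]
    field_simp
    norm_num
  -- `w i` is the supremum of the `ζ k` with `k ≥ i`, obtained as a norm limit.
  choose w hw using fun i => hnull.exists_tendsto_partialSups (z := fun j => ζ (i + j))
    fun j => hζ _
  have hle : ∀ i j, ζ (i + j) ≤ w i := fun i j =>
    ge_of_tendsto (hw i) ((eventually_ge_atTop j).mono fun N hN =>
      le_partialSups_of_le (fun j => ζ (i + j)) hN)
  have hanti : Antitone w := antitone_nat_of_succ_le fun i =>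
    le_of_tendsto' (hw (i + 1)) fun N => partialSups_le _ _ _ fun j _ => by
      have := hle i (1 + j)
      rwa [← add_assoc] at this
  have hwa : ∀ i, w i ∈ Icc 0 a := fun i =>
    ⟨(hζ i).1.trans (hle i 0), le_of_tendsto' (hw i) fun N =>
      partialSups_le _ _ _ fun j _ => (hζ _).2⟩
  have hhw : ∀ i, h i (w (i + 1)) ≤ ε / 4 := by
    intro i
    refine le_of_tendsto' (((h i).continuous.tendsto _).comp (hw (i + 1))) fun N => ?_
    have h1 : partialSups (fun j => ζ (i + 1 + j)) N ≤
        ∑ j ∈ Finset.range (N + 1), ζ (i + 1 + j) :=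
      partialSups_le _ _ _ fun j hj => Finset.single_le_sum
        (f := fun j => ζ (i + 1 + j)) (fun j _ => (hζ _).1) (Finset.mem_range.2 (by omega))
    have h2 := apply_mono (hf0 (n (G i))) h1
    rw [map_sum] at h2
    refine h2.trans ((Finset.sum_le_sum fun j _ => hsmall i j).trans ?_)
    rw [← Finset.mul_sum]
    have := sum_geometric_two_le (N + 1)
    nlinarith
  have hC : 0 ≤ C := (norm_nonneg _).trans (hfC 0)
  -- `h i` exceeds `3ε / 4` on `w i` and is at most `ε / 4` on `w (i + 1)`, so the decreasing
  -- sequence `w` cannot be Cauchy.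
  obtain ⟨i, hi⟩ := hnull.exists_norm_sub_lt hanti hwa (show 0 < ε / (2 * (C + 1)) by positivity)
  have h1 := hi (i + 1) i.le_succ
  have h2 : h i (w i - w (i + 1)) ≤ C * ‖w i - w (i + 1)‖ :=
    (le_abs_self _).trans ((h i).le_of_opNorm_le (hfC _) _)
  have h3 : h i (ζ i) ≤ h i (w i) := apply_mono (hf0 _) (hle i 0)
  have h4 : ε ≤ h i a := hfa _
  have h5 : h i (a - ζ i) + (G i).1 (ζ i) < ε / 4 := hfz _
  have h6 : 0 ≤ (G i).1 (ζ i) := apply_nonneg (G i).2 (hζ i).1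
  have h7 := hhw i
  rw [lt_div_iff₀ (by positivity)] at h1
  rw [map_sub] at h2 h5
  nlinarith [norm_nonneg (w i - w (i + 1))]

end OrderInterval

/-! ### Approximate domination by finite sums -/

section Approximation

variable {E : Type*} [NormedAddCommGroup E] [NormedSpace ℝ E] [CompleteSpace E]
  [Lattice E] [IsOrderedAddMonoid E] [IsOrderedModule ℝ E] [HasSolidNorm E]

theorem closure_nonneg {P : Set E} (hP0 : ∀ a ∈ P, 0 ≤ a) {u : E}
    (hu : u ∈ AddSubmonoid.closure P) : 0 ≤ u := by
  induction hu using AddSubmonoid.closure_induction with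
  | mem x hx => exact hP0 x hx
  | zero => exact le_rfl
  | add x y _ _ hx hy => exact add_nonneg hx hy

/-- If disjoint sequences in a bounded, downward closed set `P` of positive elements are norm null,
then `P` is approximately dominated by finite sums of its elements. -/
theorem exists_mem_closure_norm_posPart_lt {P : Set E} (hP0 : ∀ a ∈ P, 0 ≤ a)
    (hPs : ∀ a ∈ P, ∀ y, 0 ≤ y → y ≤ a → y ∈ P) {C : ℝ} (hPC : ∀ a ∈ P, ‖a‖ ≤ C)
    (hnull : ∀ v : ℕ → E, (∀ n, v n ∈ P) → (∀ m n, m ≠ n → v m ⊓ v n = 0) →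
      Tendsto (fun n => ‖v n‖) atTop (𝓝 0)) {ε : ℝ} (hε : 0 < ε) :
    ∃ u ∈ AddSubmonoid.closure P, ∀ a ∈ P, ‖(a - u)⁺‖ < ε := by
  by_contra! H
  have H' : ∀ u : AddSubmonoid.closure P, ∃ a ∈ P, ε ≤ ‖(a - u)⁺‖ := fun u => H u.1 u.2
  choose A hAP hA using H'
  -- The factor `4 ^ (k + 1)` makes `U k ≥ 4 ^ k • α i` for `i < k`, which outweighs the coefficient
  -- `2⁻ⁱ * 2⁻ᵏ` with which `2⁻ⁱ • w` dominates `α k`.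
  let U : ℕ → AddSubmonoid.closure P := fun k => Nat.rec 0
    (fun k u => 4 ^ (k + 1) • (u + ⟨A u, AddSubmonoid.subset_closure (hAP u)⟩)) k
  have hU : ∀ k, (U (k + 1)).1 = 4 ^ (k + 1) • ((U k).1 + A (U k)) := fun k => rfl
  have hU0 : ∀ k, 0 ≤ (U k).1 := fun k => closure_nonneg hP0 (U k).2
  let α : ℕ → E := fun k => A (U k)
  have hα0 : ∀ k, 0 ≤ α k := fun k => hP0 _ (hAP _)
  have hUα : ∀ i k, i < k → (4 : ℝ) ^ k • α i ≤ (U k).1 := by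
    intro i k hik
    obtain ⟨j, rfl⟩ := Nat.exists_eq_add_of_lt hik
    have key : α i ≤ (U (i + j)).1 + A (U (i + j)) := by
      rcases Nat.eq_zero_or_pos j with rfl | hj
      · exact le_add_of_nonneg_left (hU0 _)
      · refine le_add_of_le_of_nonneg ?_ (hα0 (i + j))
        clear hik
        induction j, hj using Nat.le_induction with
        | base =>
          rw [hU]
          refine (le_add_of_nonneg_left (hU0 i)).trans ?_
          exact le_self_nsmul (add_nonneg (hU0 i) (hα0 i)) (by positivity)
        | succ j hj ih =>
          rw [← add_assoc, hU]
          refine ih.trans ((le_add_of_nonneg_right (hα0 (i + j))).trans ?_)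
          exact le_self_nsmul (add_nonneg (hU0 _) (hα0 _)) (by positivity)
    rw [hU, ← Nat.cast_smul_eq_nsmul ℝ]
    push_cast
    exact smul_le_smul_of_nonneg_left key (by positivity)
  have hterm0 : ∀ k, 0 ≤ ((1 : ℝ) / 2) ^ k • α k := fun k => smul_nonneg (by positivity) (hα0 k)
  have hsum : Summable fun k => ((1 : ℝ) / 2) ^ k • α k := by
    refine Summable.of_norm_bounded (summable_geometric_two.mul_right C) fun k => ?_
    rw [norm_smul, Real.norm_of_nonneg (by positivity)]
    exact mul_le_mul_of_nonneg_left (hPC _ (hAP _)) (by positivity)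
  set w := ∑' k, ((1 : ℝ) / 2) ^ k • α k with hw
  have hαw : ∀ k, ((1 : ℝ) / 2) ^ k • α k ≤ w := fun k => hsum.le_tsum k fun j _ => hterm0 j
  have hw0 : 0 ≤ w := (hterm0 0).trans (hαw 0)
  have hww : ∀ k, 0 ≤ ((1 : ℝ) / 2) ^ k • w := fun k => smul_nonneg (by positivity) hw0
  -- `U k` removes the overlap with earlier choices and the multiple of `w` that with later ones;
  -- the latter vanishes in norm, so `v` is disjoint but not null.
  let v : ℕ → E := fun k => (α k - (U k).1 - ((1 : ℝ) / 2) ^ k • w)⁺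
  have hvP : ∀ k, v k ∈ P := fun k => by
    refine hPs _ (hAP (U k)) _ (posPart_nonneg _) ?_
    have : v k = (α k - ((U k).1 + ((1 : ℝ) / 2) ^ k • w))⁺ := by rw [← sub_sub]
    rw [this]
    exact posPart_sub_le (hα0 k) (add_nonneg (hU0 k) (hww k))
  have hdisj : ∀ i k, i < k → v i ⊓ v k = 0 := by
    intro i k hik
    have h1 : (1 : ℝ) ≤ ((1 / 2) ^ i * (1 / 2) ^ k) * 4 ^ k := by
      have h4 : (4 : ℝ) ^ k = 2 ^ k * 2 ^ k := by rw [← mul_pow]; norm_num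
      have h2 : (2 : ℝ) ^ i ≤ 2 ^ k := pow_le_pow_right₀ (by norm_num) hik.le
      rw [h4, one_div_pow, one_div_pow]
      field_simp
      exact h2
    refine inf_eq_zero_of_le
      (posPart_sub_smul_inf_eq_zero (a := α i) (b := α k) (hα0 _)
        (t := (1 / 2) ^ i * (1 / 2) ^ k) (by positivity) h1)
      (posPart_nonneg _) (posPart_nonneg _) (posPart_mono ?_) (posPart_mono ?_)
    · refine (sub_le_sub_right (sub_le_self _ (hU0 i)) _).trans (sub_le_sub_left ?_ _)
      rw [mul_smul]
      exact smul_le_smul_of_nonneg_left (hαw k) (by positivity)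
    · exact (sub_le_self _ (hww k)).trans (sub_le_sub_left (hUα i k hik) _)
  have hlow : ∀ k, ε ≤ ‖v k‖ + (1 / 2) ^ k * ‖w‖ := by
    intro k
    have h1 : (α k - (U k).1)⁺ ≤ v k + ((1 : ℝ) / 2) ^ k • w := by
      refine sup_le ?_ (add_nonneg (posPart_nonneg _) (hww k))
      rw [← sub_le_iff_le_add]
      exact le_posPart _
    calc ε ≤ ‖(α k - (U k).1)⁺‖ := hA _
      _ ≤ ‖v k + ((1 : ℝ) / 2) ^ k • w‖ := norm_le_of_nonneg_of_le (posPart_nonneg _) h1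
      _ ≤ ‖v k‖ + ‖((1 : ℝ) / 2) ^ k • w‖ := norm_add_le _ _
      _ = _ := by rw [norm_smul, Real.norm_of_nonneg (by positivity)]
  have hlim := (hnull v hvP (disjoint_of_lt hdisj)).add
    ((tendsto_pow_atTop_nhds_zero_of_lt_one (r := (1 / 2 : ℝ)) (by norm_num)
      (by norm_num)).mul_const ‖w‖)
  have := ge_of_tendsto' hlim hlow
  simp only [zero_mul, add_zero] at this
  linarith

end Approximation

/-! ### Band components of functionals and disjoint norming -/

section Component

variable {E : Type*} [NormedAddCommGroup E] [NormedSpace ℝ E]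
  [Lattice E] [IsOrderedAddMonoid E] [IsOrderedModule ℝ E] [HasSolidNorm E]

/-- The restriction `p` of a positive functional `g` to the band generated by `u ≥ 0`, given for
`x ≥ 0` by `p x = sup {g (x ⊓ k u) | k ∈ ℕ}`. -/
theorem exists_component {g : StrongDual ℝ E} (hg : 0 ≤ g) {u : E} (hu : 0 ≤ u) :
    ∃ p : StrongDual ℝ E, 0 ≤ p ∧ p ≤ g ∧
      ∀ x, 0 ≤ x → IsLUB (range fun k : ℕ => g (x ⊓ (k : ℝ) • u)) (p x) := by
  have hku : ∀ k : ℕ, 0 ≤ (k : ℝ) • u := fun k => smul_nonneg k.cast_nonneg hu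
  have hbdd : ∀ x, BddAbove (range fun k : ℕ => g (x ⊓ (k : ℝ) • u)) := fun x =>
    ⟨g x, by rintro _ ⟨k, rfl⟩; exact apply_mono hg inf_le_left⟩
  let q : E → ℝ := fun x => ⨆ k : ℕ, g (x ⊓ (k : ℝ) • u)
  have hleq : ∀ x (k : ℕ), g (x ⊓ (k : ℝ) • u) ≤ q x := fun x k => le_ciSup (hbdd x) k
  have hqg : ∀ x, q x ≤ g x := fun x => ciSup_le fun k => apply_mono hg inf_le_left
  have hq0 : ∀ x, 0 ≤ x → 0 ≤ q x := fun x hx =>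
    (apply_nonneg hg (le_inf hx (hku 0))).trans (hleq x 0)
  have hadd : ∀ x y, 0 ≤ x → 0 ≤ y → q (x + y) = q x + q y := by
    intro x y hx hy
    apply le_antisymm
    · refine ciSup_le fun k => ?_
      have := apply_mono hg (inf_add_le_of_nonneg hx hy (hku k))
      rw [map_add] at this
      exact this.trans (add_le_add (hleq x k) (hleq y k))
    · have h1 : q x ≤ q (x + y) - q y := ciSup_le fun k => by
        have h2 : q y ≤ q (x + y) - g (x ⊓ (k : ℝ) • u) := ciSup_le fun l => by
          have h3 : x ⊓ (k : ℝ) • u + y ⊓ (l : ℝ) • u ≤ (x + y) ⊓ ((k + l : ℕ) : ℝ) • u := by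
            refine le_inf (add_le_add inf_le_left inf_le_left) ?_
            push_cast
            rw [add_smul]
            exact add_le_add inf_le_right inf_le_right
          have h4 := (apply_mono hg h3).trans (hleq (x + y) (k + l))
          rw [map_add] at h4
          linarith
        linarith
      linarith
  obtain ⟨p, hp⟩ := exists_functional_of_additive hq0 hadd (C := ‖g‖) fun x hx =>
    (hqg x).trans (DualLattice.le_of_mem g ⟨hx, le_rfl⟩)
  refine ⟨p, fun x hx => ?_, fun x hx => ?_, fun x hx => ?_⟩
  · rw [hp x hx]; exact hq0 x hx
  · rw [hp x hx]; exact hqg x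
  · rw [hp x hx]; exact isLUB_ciSup (hbdd x)

theorem component_apply_self {g p : StrongDual ℝ E} {u : E} (hu : 0 ≤ u) (hpg : p ≤ g)
    (hp : IsLUB (range fun k : ℕ => g (u ⊓ (k : ℝ) • u)) (p u)) : p u = g u :=
  le_antisymm (hpg u hu) (by simpa using hp.1 ⟨1, rfl⟩)

theorem component_apply_of_disjoint {g p : StrongDual ℝ E} {u x : E} (hu : 0 ≤ u) (hx : 0 ≤ x)
    (h : x ⊓ u = 0) (hp : IsLUB (range fun k : ℕ => g (x ⊓ (k : ℝ) • u)) (p x)) : p x = 0 := by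
  have : (fun k : ℕ => g (x ⊓ (k : ℝ) • u)) = fun _ => 0 := by
    ext k
    rw [inf_smul_eq_zero hx hu h k.cast_nonneg, map_zero]
  rw [this, range_const] at hp
  exact hp.unique isLUB_singleton

/-- For large `k`, `z = x ⊓ k u` carries almost all of `p x`, while `q z = 0` because `z` is
disjoint from `v`. Splitting `x` at `z` bounds the infimum. -/
theorem component_inf_component {g g' p q : StrongDual ℝ E} {u v : E} (hu : 0 ≤ u) (hv : 0 ≤ v)
    (huv : u ⊓ v = 0) (hp0 : 0 ≤ p) (hq0 : 0 ≤ q)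
    (hp : ∀ x, 0 ≤ x → IsLUB (range fun k : ℕ => g (x ⊓ (k : ℝ) • u)) (p x))
    (hq : ∀ x, 0 ≤ x → IsLUB (range fun k : ℕ => g' (x ⊓ (k : ℝ) • v)) (q x)) :
    p ⊓ q = 0 := by
  refine le_antisymm (fun x hx => ?_) (le_inf hp0 hq0)
  rw [zero_apply]
  refine le_of_forall_pos_le_add fun η hη => ?_
  obtain ⟨_, ⟨k, rfl⟩, hk, -⟩ := (hp x hx).exists_between (sub_lt_self (p x) hη)
  have hku : 0 ≤ (k : ℝ) • u := smul_nonneg k.cast_nonneg hu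
  set z := x ⊓ (k : ℝ) • u with hz
  have hz0 : 0 ≤ z := le_inf hx hku
  have hzv : z ⊓ v = 0 := by
    rw [inf_comm] at huv
    have h1 := inf_smul_eq_zero hv hu huv k.cast_nonneg
    rw [inf_comm] at h1
    exact inf_eq_zero_of_le h1 hz0 hv inf_le_right le_rfl
  have h1 : q z = 0 := component_apply_of_disjoint hv hz0 hzv (hq z hz0)
  have h2 : g z ≤ p z := by
    have h3 := (hp z hz0).1 ⟨k, rfl⟩
    simpa [hz, inf_assoc] using h3
  have h4 := inf_apply_le q p hz0 (inf_le_left : z ≤ x)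
  rw [map_sub, h1, inf_comm] at h4
  simp only at hk
  linarith

/-- `h` is the difference of the components of `g` in the bands generated by `a⁺` and `a⁻`. The
crude bound `2g` suffices. -/
theorem exists_abs_le_apply_eq {g : StrongDual ℝ E} (hg : 0 ≤ g) (a : E) :
    ∃ h : StrongDual ℝ E, |h| ≤ g + g ∧ h a = g |a| := by
  obtain ⟨p, hp0, hpg, hp⟩ := exists_component hg (posPart_nonneg a)
  obtain ⟨q, hq0, hqg, hq⟩ := exists_component hg (negPart_nonneg a)
  refine ⟨p - q, ?_, ?_⟩
  · rw [abs_le']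
    constructor
    · exact (sub_le_self p hq0).trans (hpg.trans (le_add_of_nonneg_left hg))
    · rw [neg_sub]
      exact (sub_le_self q hp0).trans (hqg.trans (le_add_of_nonneg_left hg))
  · have hd := posPart_inf_negPart_eq_zero a
    have h1 := component_apply_self (posPart_nonneg a) hpg (hp _ (posPart_nonneg a))
    have h2 := component_apply_self (negPart_nonneg a) hqg (hq _ (negPart_nonneg a))
    have h3 := component_apply_of_disjoint (posPart_nonneg a) (negPart_nonneg a)
      (by rwa [inf_comm]) (hp _ (negPart_nonneg a))
    have h4 := component_apply_of_disjoint (negPart_nonneg a) (posPart_nonneg a) hd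
      (hq _ (posPart_nonneg a))
    have h5 : (p - q) a = (p - q) a⁺ - (p - q) a⁻ := by rw [← map_sub, posPart_sub_negPart]
    rw [h5, ← posPart_add_negPart a, map_add]
    simp only [sub_apply, h1, h2, h3, h4]
    ring

theorem exists_disjoint_norming {y a : ℕ → E} (hd : ∀ m n, m ≠ n → |y m| ⊓ |y n| = 0)
    (hya : ∀ n, |y n| ≤ |a n|) :
    ∃ h : ℕ → StrongDual ℝ E, (∀ n, ‖h n‖ ≤ 2) ∧ (∀ m n, m ≠ n → |h m| ⊓ |h n| = 0) ∧
      ∀ n, ‖y n‖ ≤ h n (a n) := by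
  -- `g n` norms `|y n|`, its component `p n` brings disjointness, and `h n` puts in the sign of `a
  -- n`.
  choose g hg0 hg1 hgy using fun n => exists_nonneg_norming (abs_nonneg (y n))
  choose p hp0 hpg hp using fun n => exists_component (hg0 n) (abs_nonneg (y n))
  choose h hh ha using fun n => exists_abs_le_apply_eq (hp0 n) (a n)
  refine ⟨h, fun n => ?_, fun m n hmn => ?_, fun n => ?_⟩
  · have h1 : |h n| ≤ |g n + g n| := (hh n).trans
      ((add_le_add (hpg n) (hpg n)).trans (le_abs_self _))
    refine (HasSolidNorm.solid h1).trans ((norm_add_le _ _).trans ?_)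
    linarith [hg1 n]
  · have h0 := component_inf_component (abs_nonneg (y m)) (abs_nonneg (y n)) (hd m n hmn)
      (hp0 m) (hp0 n) (hp m) (hp n)
    have h1 : p m ⊓ (2 : ℝ) • p n = 0 := inf_smul_eq_zero (hp0 m) (hp0 n) h0 two_pos.le
    rw [inf_comm] at h1
    have h2 := inf_smul_eq_zero (smul_nonneg two_pos.le (hp0 n)) (hp0 m) h1 two_pos.le
    rw [two_smul, two_smul, inf_comm] at h2
    exact inf_eq_zero_of_le h2 (abs_nonneg _) (abs_nonneg _) (hh m) (hh n)
  · rw [ha, ← norm_abs_eq_norm, ← hgy,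
      ← component_apply_self (abs_nonneg (y n)) (hpg n) (hp n _ (abs_nonneg _))]
    exact apply_mono (hp0 n) (hya n)

end Component

/-! ### Weak and weak* convergence of functionals -/

section Weak

theorem tendsto_toWeakSpace_zero_iff {E : Type*} [NormedAddCommGroup E] [NormedSpace ℝ E]
    {ι : Type*} {l : Filter ι} {x : ι → E} :
    Tendsto (fun i => toWeakSpace ℝ E (x i)) l (𝓝 0) ↔
      ∀ φ : StrongDual ℝ E, Tendsto (fun i => φ (x i)) l (𝓝 0) := by
  have hinj : Function.Injective (topDualPairing ℝ E).flip := by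
    intro a b hab
    refine (SeparatingDual.eq_iff_forall_dual_eq (R := ℝ)).2 fun g => ?_
    exact congrArg (fun F => F g) hab
  refine (WeakBilin.tendsto_iff_forall_eval_tendsto _ hinj).trans (forall_congr' fun φ => ?_)
  change Tendsto _ l (𝓝 (φ 0)) ↔ _
  rw [map_zero]
  rfl

variable {E : Type*} [NormedAddCommGroup E] [NormedSpace ℝ E]
  [Lattice E] [IsOrderedAddMonoid E] [IsOrderedModule ℝ E] [HasSolidNorm E]

theorem tendsto_toWeakDual_zero_iff {f : ℕ → StrongDual ℝ E} :
    Tendsto (fun n => StrongDual.toWeakDual (f n)) atTop (𝓝 0) ↔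
      ∀ x : E, 0 ≤ x → Tendsto (fun n => f n x) atTop (𝓝 0) := by
  rw [tendsto_iff_forall_eval_tendsto_topDualPairing]
  constructor
  · intro h x _
    exact h x
  · intro h x
    have := (h _ (posPart_nonneg x)).sub (h _ (negPart_nonneg x))
    simp only [← map_sub, posPart_sub_negPart, sub_zero] at this
    exact this

/-- The disjoint elements `|h n| ⊓ u` have partial sums below `u`, so `|φ|` is summable along them
for each `φ` in the bidual. -/
theorem isBoundedUawNull_of_disjoint {h : ℕ → StrongDual ℝ E} {C : ℝ} (hC : ∀ n, ‖h n‖ ≤ C)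
    (hd : ∀ m n, m ≠ n → |h m| ⊓ |h n| = 0) : IsBoundedUawNull h := by
  refine ⟨isBounded_iff_forall_norm_le.2 ⟨C, by rintro _ ⟨n, rfl⟩; exact hC n⟩, fun u hu => ?_⟩
  rw [tendsto_toWeakSpace_zero_iff]
  intro φ
  simp only [sub_zero]
  let v : ℕ → StrongDual ℝ E := fun n => |h n| ⊓ u
  have hv0 : ∀ n, 0 ≤ v n := fun n => le_inf (abs_nonneg _) hu
  have hvd : ∀ m n, m ≠ n → v m ⊓ v n = 0 := fun m n hmn =>
    inf_eq_zero_of_le (hd m n hmn) (hv0 m) (hv0 n) inf_le_left inf_le_left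
  have hφ0 : ∀ n, 0 ≤ |φ| (v n) := fun n => apply_nonneg (abs_nonneg φ) (hv0 n)
  have hs : Summable fun n => |φ| (v n) := by
    refine summable_of_sum_range_le (c := |φ| u) hφ0 fun n => ?_
    rw [← map_sum]
    exact apply_mono (abs_nonneg φ) (sum_le_of_disjoint hv0 hvd (fun n => inf_le_right) n)
  refine squeeze_zero_norm (fun n => ?_) hs.tendsto_atTop_zero
  have := DualLattice.apply_le_abs_apply φ (v n)
  rwa [abs_of_nonneg (hv0 n)] at this

theorem _root_.IsBoundedUawNull.exists_bound {f : ℕ → StrongDual ℝ E} (hf : IsBoundedUawNull f) :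
    ∃ C, 0 ≤ C ∧ ∀ n, ‖|f n|‖ ≤ C := by
  obtain ⟨C, hC⟩ := isBounded_iff_forall_norm_le.1 hf.1
  refine ⟨C, (norm_nonneg _).trans (hC _ ⟨0, rfl⟩), fun n => ?_⟩
  rw [norm_abs_eq_norm]
  exact hC _ ⟨n, rfl⟩

theorem _root_.IsBoundedUawNull.tendsto_inf_apply {f : ℕ → StrongDual ℝ E}
    (hf : IsBoundedUawNull f) {g : StrongDual ℝ E} (hg : 0 ≤ g) (a : E) :
    Tendsto (fun n => (|f n| ⊓ g) a) atTop (𝓝 0) := by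
  have h := tendsto_toWeakSpace_zero_iff.1 (hf.2 g hg) (NormedSpace.inclusionInDoubleDual ℝ E a)
  simpa using h

end Weak

/-! ### L-weakly compact images of order intervals -/

section LWeaklyCompact

variable {E : Type*} [NormedAddCommGroup E] [NormedSpace ℝ E]
  [Lattice E] [IsOrderedAddMonoid E] [IsOrderedModule ℝ E] [HasSolidNorm E]
  {F : Type*} [NormedAddCommGroup F] [NormedSpace ℝ F]
  [Lattice F] [IsOrderedAddMonoid F] [IsOrderedModule ℝ F] [HasSolidNorm F]

theorem isBounded_image_Icc (T : E →L[ℝ] F) (x : E) :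
    Bornology.IsBounded (T '' Icc (-x) x) := by
  refine isBounded_iff_forall_norm_le.2 ⟨‖T‖ * ‖x‖, ?_⟩
  rintro _ ⟨y, hy, rfl⟩
  refine (T.le_opNorm y).trans (mul_le_mul_of_nonneg_left (HasSolidNorm.solid ?_) (norm_nonneg T))
  exact (abs_le_of_mem_Icc hy).trans (le_abs_self x)

theorem eventually_abs_apply_le_of_isLWeaklyCompact [CompleteSpace F] {A : Set F} (hA : IsLWeaklyCompact A)
    {f : ℕ → StrongDual ℝ F} (hf : IsBoundedUawNull f) {ε : ℝ} (hε : 0 < ε) :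
    ∀ᶠ n in atTop, ∀ a ∈ A, |f n| |a| ≤ ε := by
  obtain ⟨-, hbdd, hnull⟩ := hA
  obtain ⟨C, hC0, hC⟩ := hf.exists_bound
  obtain ⟨R, hR⟩ := isBounded_iff_forall_norm_le.1 hbdd
  -- The positive part of the solid hull of `A`.
  let P : Set F := {p | 0 ≤ p ∧ ∃ a ∈ A, p ≤ |a|}
  have hPnull : ∀ v : ℕ → F, (∀ n, v n ∈ P) → (∀ m n, m ≠ n → v m ⊓ v n = 0) →
      Tendsto (fun n => ‖v n‖) atTop (𝓝 0) := by
    intro v hv hd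
    refine hnull v (fun n => ?_) fun m n hmn => ?_
    · obtain ⟨h0, a, ha, hle⟩ := hv n
      exact ⟨a, ha, by rwa [abs_of_nonneg h0]⟩
    · rw [abs_of_nonneg (hv m).1, abs_of_nonneg (hv n).1]
      exact hd m n hmn
  have hPs : ∀ a ∈ P, ∀ y, 0 ≤ y → y ≤ a → y ∈ P := fun p ⟨_, a, ha, hpa⟩ y hy hyp =>
    ⟨hy, a, ha, hyp.trans hpa⟩
  have hPC : ∀ p ∈ P, ‖p‖ ≤ R := fun p ⟨hp0, a, ha, hpa⟩ =>
    (HasSolidNorm.solid (by rwa [abs_of_nonneg hp0])).trans (hR a ha)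
  obtain ⟨u, hu, hua⟩ := exists_mem_closure_norm_posPart_lt (fun p hp => hp.1) hPs hPC hPnull
    (show 0 < ε / (2 * (C + 1)) by positivity)
  have hlim : Tendsto (fun n => |f n| u) atTop (𝓝 0) := by
    clear hua
    induction hu using AddSubmonoid.closure_induction with
    | mem p hp =>
      have hpnull : DisjointNull p := fun v hv => hPnull v fun n => hPs p hp _ (hv n).1 (hv n).2
      exact hpnull.tendsto_apply hp.1 (fun n => abs_nonneg _) hC fun g hg =>
        hf.tendsto_inf_apply hg p
    | zero => simp
    | add p q _ _ hp hq => simpa using hp.add hq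
  filter_upwards [hlim.eventually_lt_const (half_pos hε)] with n hn a ha
  have h1 := hua |a| ⟨abs_nonneg a, a, ha, le_rfl⟩
  have h2 : |a| ≤ u + (|a| - u)⁺ := by
    rw [← sub_le_iff_le_add']
    exact le_posPart _
  have h3 := apply_mono (abs_nonneg (f n)) h2
  have h4 : |f n| (|a| - u)⁺ ≤ C * ‖(|a| - u)⁺‖ :=
    (le_abs_self _).trans ((|f n|).le_of_opNorm_le (hC n) _)
  rw [lt_div_iff₀ (by positivity)] at h1
  rw [map_add] at h3
  nlinarith [norm_nonneg (|a| - u)⁺]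

theorem tendsto_abs_comp_of_isLWeaklyCompact [CompleteSpace F] (T : E →L[ℝ] F) {x : E}
    (hx : 0 ≤ x) (hT : IsLWeaklyCompact (T '' Icc (-x) x)) {f : ℕ → StrongDual ℝ F}
    (hf : IsBoundedUawNull f) : Tendsto (fun n => |(f n).comp T| x) atTop (𝓝 0) := by
  rw [Metric.tendsto_nhds]
  intro ε hε
  filter_upwards [eventually_abs_apply_le_of_isLWeaklyCompact hT hf (half_pos hε)] with n hn
  rw [Real.dist_0_eq_abs, abs_of_nonneg (apply_nonneg (abs_nonneg _) hx)]
  refine (abs_apply_le_of_forall hx (c := ε / 2) fun y hy => ?_).trans_lt (half_lt_self hε)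
  exact (le_abs_self _).trans ((DualLattice.apply_le_abs_apply (f n) (T y)).trans
    (hn _ (mem_image_of_mem T hy)))

theorem tendsto_apply_of_tendsto_abs_comp (T : E →L[ℝ] F) {f : ℕ → StrongDual ℝ F}
    (hf : ∀ x : E, 0 ≤ x → Tendsto (fun n => |(f n).comp T| x) atTop (𝓝 0)) {x : ℕ → E}
    (hx : IsOrderBoundedSeq x) : Tendsto (fun n => f n (T (x n))) atTop (𝓝 0) := by
  obtain ⟨a, b, hab⟩ := hx
  have hu : ∀ n, |x n| ≤ |a| ⊔ |b| := fun n => abs_le'.2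
    ⟨(hab n).2.trans ((le_abs_self b).trans le_sup_right),
      (neg_le_neg (hab n).1).trans ((neg_le_abs a).trans le_sup_left)⟩
  refine squeeze_zero_norm (fun n => ?_) 
    (hf (|a| ⊔ |b|) ((abs_nonneg a).trans le_sup_left))
  exact (DualLattice.apply_le_abs_apply ((f n).comp T) (x n)).trans
    (apply_mono (abs_nonneg _) (hu n))

theorem isLWeaklyCompact_of_tendsto_apply (T : E →L[ℝ] F)
    (hT : ∀ x : ℕ → E, IsOrderBoundedSeq x → ∀ f : ℕ → StrongDual ℝ F, IsBoundedUawNull f →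
      Tendsto (fun n => f n (T (x n))) atTop (𝓝 0)) {x : E} (hx : 0 ≤ x) :
    IsLWeaklyCompact (T '' Icc (-x) x) := by
  refine ⟨⟨T 0, 0, ⟨neg_nonpos.2 hx, hx⟩, rfl⟩, isBounded_image_Icc T x, fun y hy hd => ?_⟩
  have hy' : ∀ n, ∃ z ∈ Icc (-x) x, |y n| ≤ |T z| := fun n => by
    obtain ⟨_, ⟨z, hz, rfl⟩, h⟩ := hy n
    exact ⟨z, hz, h⟩
  choose z hz hyz using hy'
  obtain ⟨h, hC, hhd, hyh⟩ := exists_disjoint_norming hd hyz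
  exact squeeze_zero (fun n => norm_nonneg _) hyh
    (hT z ⟨-x, x, hz⟩ h (isBoundedUawNull_of_disjoint hC hhd))

end LWeaklyCompact

/-! ### Order continuity of the norm -/

section OrderContinuous

universe u

variable {E : Type u} [NormedAddCommGroup E] [NormedSpace ℝ E]
  [Lattice E] [IsOrderedAddMonoid E] [IsOrderedModule ℝ E] [HasSolidNorm E]

theorem disjointNull_of_isLWeaklyCompact {x : E} (h : IsLWeaklyCompact (Icc (-x) x)) :
    DisjointNull x := by
  intro v hv hd
  refine h.2.2 v (fun n => ?_) fun m n hmn => ?_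
  · have hx : 0 ≤ x := (hv n).1.trans (hv n).2
    refine ⟨x, ⟨neg_le_self hx, le_rfl⟩, ?_⟩
    rw [abs_of_nonneg (hv n).1, abs_of_nonneg hx]
    exact (hv n).2
  · rw [abs_of_nonneg (hv m).1, abs_of_nonneg (hv n).1]
    exact hd m n hmn

theorem isOrderContinuousLattice_of_disjointNull [CompleteSpace E]
    (h : ∀ x : E, 0 ≤ x → DisjointNull x) : IsOrderContinuousLattice E := by
  intro ι _ _ _ x hx hglb
  obtain ⟨i₀⟩ := ‹Nonempty ι›
  have hx0 : ∀ i, 0 ≤ x i := fun i => hglb.1 ⟨i, rfl⟩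
  -- Only the tail beyond `i₀` is known to lie in the order interval `[0, x i₀]`.
  have : IsDirectedOrder (Ici i₀) := ⟨fun i j => by
    obtain ⟨k, hik, hjk⟩ := exists_ge_ge i.1 j.1
    exact ⟨⟨k, i.2.trans hik⟩, hik, hjk⟩⟩
  have : Nonempty (Ici i₀) := ⟨⟨i₀, le_rfl⟩⟩
  have hanti : Antitone fun i : Ici i₀ => x i := fun i j hij => hx hij
  obtain ⟨y, hy⟩ := CompleteSpace.complete ((h (x i₀) (hx0 i₀)).cauchy
    hanti fun i => ⟨hx0 i, hx i.2⟩)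
  have hy' : Tendsto (fun i : Ici i₀ => x i) atTop (𝓝 y) := hy
  have hyx : ∀ i, y ≤ x i := fun i => by
    obtain ⟨k, hik, hk⟩ := exists_ge_ge i i₀
    refine le_of_tendsto hy' ((eventually_ge_atTop (⟨k, hk⟩ : Ici i₀)).mono fun j hj => ?_)
    exact hx (hik.trans hj)
  have hy0 : y = 0 := le_antisymm (hglb.2 (by rintro _ ⟨i, rfl⟩; exact hyx i))
    (ge_of_tendsto' hy' fun i => hx0 i)
  subst hy0
  rw [Metric.tendsto_nhds]
  intro ε hε
  obtain ⟨j, hj⟩ := (Metric.tendsto_nhds.1 hy' ε hε).exists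
  filter_upwards [eventually_ge_atTop j.1] with i hi
  rw [dist_zero_right] at hj
  rw [dist_zero_right, norm_norm]
  exact (norm_le_of_nonneg_of_le (hx0 i) (hx hi)).trans_lt hj

theorem eq_zero_of_forall_nsmul_le {v x : E} (hv : 0 ≤ v) (h : ∀ k : ℕ, k • v ≤ x) : v = 0 := by
  by_contra hne
  obtain ⟨k, hk⟩ := exists_nat_gt (‖x‖ / ‖v‖)
  have h1 := norm_le_of_nonneg_of_le (nsmul_nonneg hv k) (h k)
  rw [← Nat.cast_smul_eq_nsmul ℝ, norm_smul, Real.norm_natCast] at h1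
  rw [div_lt_iff₀ (norm_pos_iff.2 hne)] at hk
  linarith

/-- For a bounded increasing sequence `s`, the differences between its upper bounds and its terms
have infimum `0`. -/
theorem isGLB_upperBounds_sub {s : ℕ → E} {x : E} (hx : ∀ n, s n ≤ x) :
    IsGLB {d | ∃ b ∈ upperBounds (range s), ∃ n, d = b - s n} 0 := by
  constructor
  · rintro _ ⟨b, hb, n, rfl⟩
    exact sub_nonneg.2 (hb ⟨n, rfl⟩)
  · intro v hv
    have hv' : ∀ b ∈ upperBounds (range s), ∀ n, v⁺ ≤ b - s n := fun b hb n =>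
      sup_le (hv ⟨b, hb, n, rfl⟩) (sub_nonneg.2 (hb ⟨n, rfl⟩))
    -- Lowering an upper bound by `v⁺` leaves an upper bound, so every multiple of `v⁺` stays below
    -- `x - s 0`.
    have hstep : ∀ k : ℕ, x - k • v⁺ ∈ upperBounds (range s) := by
      intro k
      induction k with
      | zero => rintro _ ⟨n, rfl⟩; simpa using hx n
      | succ k ih =>
        rintro _ ⟨n, rfl⟩
        rw [succ_nsmul, ← sub_sub, le_sub_comm]
        exact hv' _ ih n
    have h0 : v⁺ = 0 := eq_zero_of_forall_nsmul_le (x := x - s 0) (posPart_nonneg v) fun k => by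
      rw [le_sub_comm]
      exact hstep k ⟨0, rfl⟩
    exact (le_posPart v).trans h0.le

theorem isLWeaklyCompact_Icc_of_isOrderContinuousLattice (hE : IsOrderContinuousLattice E) {x : E}
    (hx : 0 ≤ x) : IsLWeaklyCompact (Icc (-x) x) := by
  refine ⟨⟨0, neg_nonpos.2 hx, hx⟩, ?_, fun y hy hd => ?_⟩
  · simpa using isBounded_image_Icc (ContinuousLinearMap.id ℝ E) x
  have hyx : ∀ n, |y n| ≤ x := fun n => by
    obtain ⟨z, hz, h⟩ := hy n
    exact h.trans (abs_le_of_mem_Icc hz)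
  let s : ℕ → E := fun n => ∑ i ∈ Finset.range n, |y i|
  have hs : Monotone s := monotone_nat_of_le_succ fun n => by
    simp only [s, Finset.sum_range_succ]
    exact le_add_of_nonneg_right (abs_nonneg _)
  have hsx : ∀ n, s n ≤ x := sum_le_of_disjoint (fun n => abs_nonneg (y n)) hd hyx
  -- The partial sums need not have a supremum, so all their upper bounds are used; `D` is directed
  -- downwards.
  let D : Set E := {d | ∃ b ∈ upperBounds (range s), ∃ n, d = b - s n}
  have hD : IsGLB D 0 := isGLB_upperBounds_sub hsx
  have : Nonempty Dᵒᵈ := ⟨⟨x - s 0, x, by rintro _ ⟨n, rfl⟩; exact hsx n, 0, rfl⟩⟩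
  have : IsDirectedOrder Dᵒᵈ := ⟨by
    rintro ⟨_, b, hb, m, rfl⟩ ⟨_, c, hc, n, rfl⟩
    refine ⟨⟨b ⊓ c - s (max m n), b ⊓ c, fun z hz => le_inf (hb hz) (hc hz), _, rfl⟩, ?_, ?_⟩
    · exact sub_le_sub inf_le_left (hs (le_max_left m n))
    · exact sub_le_sub inf_le_right (hs (le_max_right m n))⟩
  have hlim := hE Dᵒᵈ (fun d => (OrderDual.ofDual d : D).1) (fun c d h => h) (by
    convert hD using 1
    exact Subtype.range_coe)
  rw [Metric.tendsto_atTop]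
  intro ε hε
  obtain ⟨⟨_, b, hb, n, rfl⟩, hn⟩ := (hlim.eventually_lt_const hε).exists
  refine ⟨n, fun m hm => ?_⟩
  -- For `m ≥ n`, `|y m| = s (m + 1) - s m ≤ b - s n`.
  rw [dist_zero_right, norm_norm, ← norm_abs_eq_norm]
  refine (norm_le_of_nonneg_of_le (abs_nonneg _) ?_).trans_lt hn
  change |y m| ≤ b - s n
  have h1 : s (m + 1) ≤ b := hb ⟨m + 1, rfl⟩
  have h2 : s n ≤ s m := hs hm
  rw [le_sub_iff_add_le']
  refine le_trans (add_le_add_left h2 _) ?_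
  simpa [s, Finset.sum_range_succ] using h1

end OrderContinuous

end BanachLattice

theorem mainTheorem8
    {E : Type*} [NormedAddCommGroup E] [NormedSpace ℝ E] [CompleteSpace E]
    [Lattice E] [IsOrderedAddMonoid E] [IsOrderedModule ℝ E] [HasSolidNorm E]
    {F : Type*} [NormedAddCommGroup F] [NormedSpace ℝ F] [CompleteSpace F]
    [Lattice F] [IsOrderedAddMonoid F] [IsOrderedModule ℝ F] [HasSolidNorm F] :
    (∀ T : E →L[ℝ] F, List.TFAE [
      ∀ x : E, 0 ≤ x → IsLWeaklyCompact (T '' Icc (-x) x),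
      ∀ f : ℕ → StrongDual ℝ F, IsBoundedUawNull f →
        Tendsto (fun n => StrongDual.toWeakDual |(f n).comp T|) atTop (𝓝 0),
      ∀ x : ℕ → E, IsOrderBoundedSeq x → ∀ f : ℕ → StrongDual ℝ F, IsBoundedUawNull f →
        Tendsto (fun n => f n (T (x n))) atTop (𝓝 0)]) ∧
    List.TFAE [
      ∀ x : E, 0 ≤ x → IsLWeaklyCompact (Icc (-x) x),
      ∀ f : ℕ → StrongDual ℝ E, IsBoundedUawNull f →
        Tendsto (fun n => StrongDual.toWeakDual |f n|) atTop (𝓝 0),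
      IsOrderContinuousLattice E] := by
  constructor
  · intro T
    tfae_have 1 → 2 := fun h f hf => BanachLattice.tendsto_toWeakDual_zero_iff.2 fun x hx =>
      BanachLattice.tendsto_abs_comp_of_isLWeaklyCompact T hx (h x hx) hf
    tfae_have 2 → 3 := fun h x hx f hf => BanachLattice.tendsto_apply_of_tendsto_abs_comp T
      (BanachLattice.tendsto_toWeakDual_zero_iff.1 (h f hf)) hx
    tfae_have 3 → 1 := fun h x hx => BanachLattice.isLWeaklyCompact_of_tendsto_apply T h hx
    tfae_finish
  · tfae_have 1 → 2 := fun h f hf => BanachLattice.tendsto_toWeakDual_zero_iff.2 fun x hx => by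
      have := BanachLattice.tendsto_abs_comp_of_isLWeaklyCompact (ContinuousLinearMap.id ℝ E) hx
        (by simpa using h x hx) hf
      simpa using this
    tfae_have 2 → 1 := fun h x hx => by
      have := BanachLattice.isLWeaklyCompact_of_tendsto_apply (ContinuousLinearMap.id ℝ E)
        (fun z hz f hf => BanachLattice.tendsto_apply_of_tendsto_abs_comp _
          (by simpa using BanachLattice.tendsto_toWeakDual_zero_iff.1 (h f hf)) hz) hx
      simpa using this
    tfae_have 1 → 3 := fun h => BanachLattice.isOrderContinuousLattice_of_disjointNull fun x hx =>
      BanachLattice.disjointNull_of_isLWeaklyCompact (h x hx)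
    tfae_have 3 → 1 := fun h x hx =>
      BanachLattice.isLWeaklyCompact_Icc_of_isOrderContinuousLattice h hx
    tfae_finish
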